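/- Let $X$ be a complex algebraic variety (a reduced, separated scheme of finite type over $\mathbb{C}$) and let $L$ be a line bundle on $X$ whose complete linear system separates points and tangent vectors; this holds in particular when $L$ gives an embedding $X\subset\mathbb{P}(H^0(X,L)^*)=\mathbb{P}W$. A closed point $x\in X$ is identified with the point $[v]\in\mathbb{P}W$, where $0\neq v\in W=H^0(X,L)^*$ is a functional whose kernel is the space of sections of $L$ vanishing at $x$. Let $f\in W$ and let $f=\sum_{i=1}^k v_i$ be a minimal decomposition, i.e. $v_i\in W\setminus\{0\}$, $[v_i]=z_i$ with $z_i\in X$ a closed point, and $k$ is the least number of summands in an expression of $f$ of this kind. Put $Z=\{z_1,\dots,z_k\}$, with ideal sheaf $\mathcal{I}_Z$. Let $E$ be a vector bundle on $X$ (locally free of constant finite rank), and let $$A_f\colon H^0(E)\to H^0(E^*\otimes L)^*,\qquad A_f(s)(t)=f(\langle s,t\rangle),$$ where $\langle\cdot,\cdot\rangle\colon H^0(E)\otimes H^0(E^*\otimes L)\to H^0(L)$ is the natural contraction. Let $(\operatorname{im}A_f)^\perp\subseteq H^0(E^*\otimes L)$ be the space of all $t$ with $A_f(s)(t)=0$ for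 every $s\in H^0(E)$. If $$\operatorname{rank}A_f=k\cdot\operatorname{rank}E,$$ then $$H^0(\mathcal{I}_Z\otimes E)=\ker A_f\qquad\text{and}\qquad H^0(\mathcal{I}_Z\otimes E^*\otimes L)=(\operatorname{im}A_f)^\perp,$$ where the left-hand sides are regarded as the subspaces of sections of $E$, respectively of $E^*\otimes L$, that vanish on $Z$. -/

import Mathlib

open CategoryTheory AlgebraicGeometry TopologicalSpace
open scoped AlgebraicGeometry

namespace WaringBundle

noncomputable section

/-- Restriction of sections of an `𝒪_X`-module to a smaller open set. -/
def res {X : Scheme.{0}} (M : X.Modules) {U V : X.Opens} (h : V ≤ U) : Γ(M, U) →+ Γ(M, V) :=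
  (M.presheaf.map (homOfLE h).op).hom

/-- Restriction of regular functions to a smaller open set. -/
def resO (X : Scheme.{0}) {U V : X.Opens} (h : V ≤ U) : Γ(X, U) →+* Γ(X, V) :=
  (X.presheaf.map (homOfLE h).op).hom

theorem res_smul {X : Scheme.{0}} (M : X.Modules) {U V : X.Opens} (h : V ≤ U)
    (r : Γ(X, U)) (x : Γ(M, U)) : res M h (r • x) = resO X h r • res M h x :=
  Scheme.Modules.map_smul M (homOfLE h) r x

theorem res_res {X : Scheme.{0}} (M : X.Modules) {U V W : X.Opens} (h : V ≤ U) (h' : W ≤ V)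
    (x : Γ(M, U)) : res M h' (res M h x) = res M (h'.trans h) x := by
  have : (homOfLE (h'.trans h)).op = (homOfLE h).op ≫ (homOfLE h').op := rfl
  simp only [res]
  rw [this, M.presheaf.map_comp]
  rfl

theorem resO_resO (X : Scheme.{0}) {U V W : X.Opens} (h : V ≤ U) (h' : W ≤ V)
    (x : Γ(X, U)) : resO X h' (resO X h x) = resO X (h'.trans h) x := by
  have : (homOfLE (h'.trans h)).op = (homOfLE h).op ≫ (homOfLE h').op := rfl
  simp only [resO]
  rw [this, X.presheaf.map_comp]
  rfl

/-- `M` is locally free of rank `e`: near every point there is a local frame. -/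
def IsLocallyFreeOfRank {X : Scheme.{0}} (M : X.Modules) (e : ℕ) : Prop :=
  ∀ x : X, ∃ (U : X.Opens) (_ : x ∈ U) (b : Fin e → Γ(M, U)),
    ∀ (V : X.Opens) (h : V ≤ U),
      Function.Bijective fun c : Fin e → Γ(X, V) => ∑ j, c j • res M h (b j)

/-- A section over `U` of the dual sheaf `E^* = ℋom(E, 𝒪_X)`: a morphism `E|_U → 𝒪_U`. -/
@[ext]
structure DualSection {X : Scheme.{0}} (E : X.Modules) (U : X.Opens) where
  app : ∀ V : X.Opens, V ≤ U → (Γ(E, V) →ₗ[Γ(X, V)] Γ(X, V))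
  res_app : ∀ (V W : X.Opens) (hV : V ≤ U) (hW : W ≤ V) (s : Γ(E, V)),
    resO X hW (app V hV s) = app W (hW.trans hV) (res E hW s)

namespace DualSection

variable {X : Scheme.{0}} {E : X.Modules} {U : X.Opens}

instance : Zero (DualSection E U) := ⟨⟨fun _ _ => 0, by simp⟩⟩
instance : Add (DualSection E U) :=
  ⟨fun a b => ⟨fun V h => a.app V h + b.app V h, by simp [a.res_app, b.res_app]⟩⟩
instance : Neg (DualSection E U) :=
  ⟨fun a => ⟨fun V h => - a.app V h, by simp [a.res_app]⟩⟩
instance : SMul Γ(X, U) (DualSection E U) :=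
  ⟨fun r a => ⟨fun V h => resO X h r • a.app V h, by simp [a.res_app, resO_resO]⟩⟩
@[simp] theorem add_app (a b : DualSection E U) (V : X.Opens) (h : V ≤ U) :
    (a + b).app V h = a.app V h + b.app V h := rfl
@[simp] theorem neg_app (a : DualSection E U) (V : X.Opens) (h : V ≤ U) :
    (-a).app V h = -a.app V h := rfl
@[simp] theorem zero_app (V : X.Opens) (h : V ≤ U) :
    (0 : DualSection E U).app V h = 0 := rfl
@[simp] theorem smul_app (r : Γ(X, U)) (a : DualSection E U) (V : X.Opens) (h : V ≤ U) :
    (r • a).app V h = resO X h r • a.app V h := rfl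

instance : AddCommGroup (DualSection E U) where
  add_assoc a b c := by ext; simp [add_assoc]
  zero_add a := by ext; simp
  add_zero a := by ext; simp
  add_comm a b := by ext; simp [add_comm]
  neg_add_cancel a := by ext; simp
  nsmul := nsmulRec
  zsmul := zsmulRec

instance : Module Γ(X, U) (DualSection E U) where
  one_smul a := by ext; simp
  mul_smul r s a := by ext; simp [mul_smul]
  smul_zero r := by ext; simp
  smul_add r a b := by ext; simp
  add_smul r s a := by ext; simp [add_smul]
  zero_smul a := by ext; simp

/-- Restriction of sections of `E^*`. -/
def restrict {V : X.Opens} (hV : V ≤ U) (a : DualSection E U) : DualSection E V :=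
  ⟨fun W h => a.app W (h.trans hV), fun _ _ _ _ _ => a.res_app _ _ _ _ _⟩

end DualSection

/-- The dual `E^* = ℋom(E, 𝒪_X)`. -/
def dual {X : Scheme.{0}} (E : X.Modules) : X.PresheafOfModules :=
  letI P : (X.Opens)ᵒᵖ ⥤ Ab :=
    { obj := fun U => AddCommGrpCat.of (DualSection E U.unop)
      map := fun {_ _} f => AddCommGrpCat.ofHom
        (AddMonoidHom.mk' (DualSection.restrict (leOfHom f.unop)) fun _ _ => rfl) }
  letI : ∀ U, Module (X.ringCatSheaf.obj.obj U) (P.obj U) := fun U =>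
    inferInstanceAs (Module Γ(X, U.unop) (DualSection E U.unop))
  PresheafOfModules.ofPresheaf (R := X.ringCatSheaf.obj) P
    (fun {U V} f r m => by
      apply DualSection.ext
      funext W h
      exact congrArg (· • DualSection.app m W _) (resO_resO X (leOfHom f.unop) h r).symm)

/-- The tensor product of (pre)sheaves of `𝒪_X`-modules: the sheaf associated with
`U ↦ P(U) ⊗ Q(U)`. -/
def tensor {X : Scheme.{0}} (P Q : X.PresheafOfModules) : X.Modules :=
  (PresheafOfModules.sheafification (𝟙 X.ringCatSheaf.obj)).obj
    (PresheafOfModules.Monoidal.tensorObj (R := X.presheaf) P Q)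

/-- The sheaf `E^* ⊗ L`. -/
def dualTensor {X : Scheme.{0}} (E L : X.Modules) : X.Modules := tensor (dual E) L.val

theorem contract_aux {X : Scheme.{0}} (E L : X.Modules) (s : Γ(E, ⊤)) {U V : X.Opens}
    (h : V ≤ U) (φ : DualSection E U) (l : Γ(L, U)) :
    res L h (φ.app U le_rfl (res E le_top s) • l) =
      (φ.restrict h).app V le_rfl (res E le_top s) • res L h l := by
  rw [res_smul, DualSection.res_app, res_res]
  rfl

/-- Contraction with a global section `s` of `E`, on the presheaf `U ↦ E^*(U) ⊗ L(U)`: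
`φ ⊗ l ↦ φ(s) l`. -/
def contractPre {X : Scheme.{0}} (E L : X.Modules) (s : Γ(E, ⊤)) :
    PresheafOfModules.Monoidal.tensorObj (R := X.presheaf) (dual E) L.val ⟶
      (PresheafOfModules.restrictScalars (𝟙 X.ringCatSheaf.obj)).obj L.val where
  app U := ModuleCat.MonoidalCategory.tensorLift (R := Γ(X, U.unop))
    (M₁ := (ModuleCat.of Γ(X, U.unop) (DualSection E U.unop)))
    (M₂ := (ModuleCat.of Γ(X, U.unop) Γ(L, U.unop)))
    (M₃ := (ModuleCat.of Γ(X, U.unop) Γ(L, U.unop)))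
    (fun φ l => φ.app U.unop le_rfl (res E le_top s) • l)
    (fun _ _ _ => add_smul _ _ _)
    (fun a φ l => by
      have : resO X (le_refl U.unop) a = a := by
        simp [resO]
      change (resO X (le_refl U.unop) a * φ.app U.unop le_rfl (res E le_top s)) • l = _
      rw [this, mul_smul])
    (fun _ _ _ => smul_add _ _ _)
    (fun _ _ _ => smul_comm _ _ _)
  naturality {U V} f := by
    refine ModuleCat.MonoidalCategory.tensor_ext (fun φ l => ?_)
    change DualSection.app (DualSection.restrict (leOfHom f.unop) φ) V.unop le_rfl
        (res E le_top s) • res L (leOfHom f.unop) l =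
      res L (leOfHom f.unop) (DualSection.app φ U.unop le_rfl (res E le_top s) • l)
    exact (contract_aux E L s (leOfHom f.unop) φ l).symm

/-- Contraction `E^* ⊗ L → L` with a global section of `E`. -/
def contractHom {X : Scheme.{0}} (E L : X.Modules) (s : Γ(E, ⊤)) : dualTensor E L ⟶ L :=
  (PresheafOfModules.sheafificationHomEquiv (𝟙 X.ringCatSheaf.obj)).symm (contractPre E L s)

/-- The section `φ ⊗ l` of `E^* ⊗ L`. -/
def tmul {X : Scheme.{0}} {E L : X.Modules} {U : X.Opens} (φ : DualSection E U) (l : Γ(L, U)) :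
    Γ(dualTensor E L, U) :=
  (PresheafOfModules.sheafificationHomEquiv (𝟙 X.ringCatSheaf.obj)
    (P := PresheafOfModules.Monoidal.tensorObj (R := X.presheaf) (dual E) L.val)
    (F := dualTensor E L) (𝟙 _)).app (.op U) (TensorProduct.tmul Γ(X, U) φ l)

theorem hom_ext_tmul {X : Scheme.{0}} {E L : X.Modules} {a b : dualTensor E L ⟶ L}
    (h : ∀ (U : X.Opens) (φ : DualSection E U) (l : Γ(L, U)),
      a.app U (tmul φ l) = b.app U (tmul φ l)) : a = b := by
  apply (PresheafOfModules.sheafificationHomEquiv (𝟙 X.ringCatSheaf.obj)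
    (P := PresheafOfModules.Monoidal.tensorObj (R := X.presheaf) (dual E) L.val) (F := L)).injective
  apply PresheafOfModules.hom_ext
  intro U
  exact ModuleCat.MonoidalCategory.tensor_ext (R := Γ(X, U.unop)) (fun φ l => h U.unop φ l)

/-- The contraction is `φ ⊗ l ↦ φ(s) l`. -/
theorem contractHom_tmul {X : Scheme.{0}} (E L : X.Modules) (s : Γ(E, ⊤)) (U : X.Opens)
    (φ : DualSection E U) (l : Γ(L, U)) :
    (contractHom E L s).app U (tmul φ l) = φ.app U le_rfl (res E le_top s) • l := by
  have h : PresheafOfModules.sheafificationHomEquiv (𝟙 X.ringCatSheaf.obj) (contractHom E L s) =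
      contractPre E L s := Equiv.apply_symm_apply _ _
  have h2 := congrArg (fun k => PresheafOfModules.Hom.app k (.op U)) h
  exact congrArg (fun k => k.hom (TensorProduct.tmul Γ(X, U) φ l)) h2

theorem contractHom_add {X : Scheme.{0}} (E L : X.Modules) (s t : Γ(E, ⊤)) :
    contractHom E L (s + t) = contractHom E L s + contractHom E L t := by
  apply hom_ext_tmul
  intro U φ l
  rw [contractHom_tmul, map_add, map_add, add_smul, ← contractHom_tmul, ← contractHom_tmul]
  rfl

/-- Multiplication by a global function, as an endomorphism of `L`. -/
def scale {X : Scheme.{0}} (L : X.Modules) (r : Γ(X, ⊤)) : L ⟶ L :=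
  SheafOfModules.Hom.mk <| PresheafOfModules.homMk
    { app := fun U => AddCommGrpCat.ofHom
        (DistribSMul.toAddMonoidHom Γ(L, U.unop) (resO X (le_top : U.unop ≤ ⊤) r))
      naturality := fun U V f => by
        ext x
        have := res_smul L (leOfHom f.unop) (resO X le_top r) x
        rw [resO_resO] at this
        exact this.symm }
    (fun U c x => smul_comm (M := Γ(X, U.unop)) (N := Γ(X, U.unop)) (α := Γ(L, U.unop)) _ _ _)

theorem scale_app {X : Scheme.{0}} (L : X.Modules) (r : Γ(X, ⊤)) (U : X.Opens) (x : Γ(L, U)) :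
    (scale L r).app U x = resO X (le_top : U ≤ ⊤) r • x := rfl

theorem contractHom_smul {X : Scheme.{0}} (E L : X.Modules) (r : Γ(X, ⊤)) (s : Γ(E, ⊤)) :
    contractHom E L (r • s) = contractHom E L s ≫ scale L r := by
  apply hom_ext_tmul
  intro U φ l
  rw [contractHom_tmul, res_smul, map_smul, smul_assoc, ← contractHom_tmul]
  exact (scale_app L r U _).symm

theorem contract_add {X : Scheme.{0}} (E L : X.Modules) (s s' : Γ(E, ⊤))
    (t : Γ(dualTensor E L, ⊤)) :
    ((contractHom E L (s + s')).app ⊤).hom t =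
      ((contractHom E L s).app ⊤).hom t + ((contractHom E L s').app ⊤).hom t := by
  rw [contractHom_add]
  rfl

theorem contract_smul {X : Scheme.{0}} (E L : X.Modules) (r : Γ(X, ⊤)) (s : Γ(E, ⊤))
    (t : Γ(dualTensor E L, ⊤)) :
    ((contractHom E L (r • s)).app ⊤).hom t = r • ((contractHom E L s).app ⊤).hom t := by
  rw [contractHom_smul]
  have h : resO X (le_refl (⊤ : X.Opens)) r = r := by simp [resO]
  refine (scale_app L r ⊤ (((contractHom E L s).app ⊤).hom t)).trans ?_
  rw [h]

/-- The ring homomorphism `ℂ → Γ(X, 𝒪_X)` of a complex scheme. -/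
def structureHom {X : Scheme.{0}} (π : X ⟶ Spec (.of ℂ)) : ℂ →+* Γ(X, ⊤) :=
  π.appTop.hom.comp (Scheme.ΓSpecIso (.of ℂ)).inv.hom

/-- The complex vector space `H⁰(X, M)` of global sections. -/
def H0 {X : Scheme.{0}} (_π : X ⟶ Spec (.of ℂ)) (M : X.Modules) : Type := Γ(M, ⊤)

variable {X : Scheme.{0}} (π : X ⟶ Spec (.of ℂ))

instance (M : X.Modules) : AddCommGroup (H0 π M) := inferInstanceAs (AddCommGroup Γ(M, ⊤))

instance (M : X.Modules) : Module ℂ (H0 π M) := Module.compHom Γ(M, ⊤) (structureHom π)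

/-- The contraction `H⁰(E) × H⁰(E^* ⊗ L) → H⁰(L)`. -/
def contract (E L : X.Modules) : H0 π E →ₗ[ℂ] H0 π (dualTensor E L) →ₗ[ℂ] H0 π L :=
  LinearMap.mk₂ ℂ (fun s t => ((contractHom E L s).app ⊤).hom t)
    (fun s s' t => contract_add E L s s' t)
    (fun c s t => contract_smul E L (structureHom π c) s t)
    (fun s t t' => map_add ((contractHom E L s).app ⊤).hom t t')
    (fun c s t => Scheme.Modules.Hom.app_smul (contractHom E L s) (structureHom π c) t)

/-- The map `A_f : H⁰(E) → H⁰(E^* ⊗ L)^*`, `A_f(s)(t) = f(⟨s, t⟩)`, for `f ∈ H⁰(L)^*`. -/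
def mapA (E L : X.Modules) (f : Module.Dual ℂ (H0 π L)) :
    H0 π E →ₗ[ℂ] Module.Dual ℂ (H0 π (dualTensor E L)) :=
  (contract π E L).compr₂ f

/-- The sections over `U` of the ideal sheaf `I_Z`: the regular functions on `U` that vanish
at all points of `Z` in `U`. -/
def idealOf (Z : Set X) (U : X.Opens) : Ideal Γ(X, U) :=
  ⨅ (x : X) (hx : x ∈ U) (_ : x ∈ Z), RingHom.ker (X.evaluation U x hx).hom

theorem mem_idealOf {Z : Set X} {U : X.Opens} {g : Γ(X, U)} :
    g ∈ idealOf Z U ↔ ∀ (x : X) (hx : x ∈ U), x ∈ Z → X.evaluation U x hx g = 0 := by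
  simp only [idealOf, Submodule.mem_iInf]
  rfl

theorem resO_mem_idealOf {Z : Set X} {U V : X.Opens} (h : V ≤ U) {g : Γ(X, U)}
    (hg : g ∈ idealOf Z U) : resO X h g ∈ idealOf Z V := by
  rw [mem_idealOf] at hg ⊢
  intro x hx hxZ
  rw [← hg x (h hx) hxZ]
  have := X.presheaf.germ_res (homOfLE h) x hx
  have h2 := congrArg (fun k => k ≫ X.residue x) this
  exact congrArg (fun k => k.hom g) h2

theorem res_mem_smul_top {Z : Set X} (M : X.Modules) {U V : X.Opens} (h : V ≤ U) {s : Γ(M, U)}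
    (hs : s ∈ idealOf Z U • (⊤ : Submodule Γ(X, U) Γ(M, U))) :
    res M h s ∈ idealOf Z V • (⊤ : Submodule Γ(X, V) Γ(M, V)) := by
  refine Submodule.smul_induction_on hs (fun r hr n _ => ?_) (fun a b ha hb => ?_)
  · rw [res_smul]
    exact Submodule.smul_mem_smul (resO_mem_idealOf h hr) trivial
  · rw [map_add]
    exact add_mem ha hb

/-- A global section of `M` lies in the subsheaf `I_Z M`: locally it is in `I_Z(U) M(U)`. -/
def VanishesOn (M : X.Modules) (Z : Set X) (s : Γ(M, ⊤)) : Prop :=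
  ∀ x : X, ∃ (U : X.Opens) (_ : x ∈ U),
    res M (le_top : U ≤ ⊤) s ∈ idealOf Z U • (⊤ : Submodule Γ(X, U) Γ(M, U))

theorem VanishesOn.add {M : X.Modules} {Z : Set X} {a b : Γ(M, ⊤)} (ha : VanishesOn M Z a)
    (hb : VanishesOn M Z b) : VanishesOn M Z (a + b) := by
  intro x
  obtain ⟨U, hU, h1⟩ := ha x
  obtain ⟨V, hV, h2⟩ := hb x
  refine ⟨U ⊓ V, ⟨hU, hV⟩, ?_⟩
  have h1' := res_mem_smul_top M (inf_le_left : U ⊓ V ≤ U) h1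
  have h2' := res_mem_smul_top M (inf_le_right : U ⊓ V ≤ V) h2
  rw [res_res] at h1' h2'
  rw [map_add]
  exact add_mem h1' h2'

theorem VanishesOn.smul {M : X.Modules} {Z : Set X} (r : Γ(X, ⊤)) {a : Γ(M, ⊤)}
    (ha : VanishesOn M Z a) : VanishesOn M Z (r • a) := by
  intro x
  obtain ⟨U, hU, h1⟩ := ha x
  refine ⟨U, hU, ?_⟩
  rw [res_smul]
  exact Submodule.smul_mem _ _ h1

theorem VanishesOn.zero (M : X.Modules) (Z : Set X) : VanishesOn M Z 0 := by
  intro x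
  refine ⟨⊤, trivial, ?_⟩
  rw [map_zero]
  exact zero_mem _

/-- `H⁰(I_Z ⊗ M)` as a subspace of `H⁰(M)`, for `M` locally free (when `I_Z ⊗ M = I_Z M ⊆ M`):
the global sections of the subsheaf `I_Z M`. -/
def H0Ideal (M : X.Modules) (Z : Set X) : Submodule ℂ (H0 π M) where
  carrier := {s | VanishesOn M Z s}
  zero_mem' := VanishesOn.zero M Z
  add_mem' ha hb := VanishesOn.add ha hb
  smul_mem' c _ ha := VanishesOn.smul (structureHom π c) ha

/-- The complete linear system of the line bundle `L` separates points and tangent vectors: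
sections separate closed points, and at every closed point `x` they have all possible 1-jets,
i.e. `H⁰(L) → L_x / 𝔪_x² L_x` is surjective. -/
structure SeparatesPointsAndTangents (L : X.Modules) : Prop where
  points : ∀ x y : X, IsClosed {x} → IsClosed {y} → x ≠ y →
    ∃ s ∈ H0Ideal π L {x}, s ∉ H0Ideal π L {y}
  jets : ∀ x : X, IsClosed {x} → ∀ (U : X.Opens), x ∈ U → ∀ t : Γ(L, U),
    ∃ (s : H0 π L) (V : X.Opens) (h : V ≤ U), x ∈ V ∧
      res L (le_top : V ≤ ⊤) s - res L h t ∈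
        (idealOf {x} V) ^ 2 • (⊤ : Submodule Γ(X, V) Γ(L, V))

/-- `[v] = x` in `ℙ(H⁰(L)^*)`, where the closed point `x` of `X` is identified with the hyperplane
of sections of `L` that vanish at `x`. -/
def Represents (L : X.Modules) (v : Module.Dual ℂ (H0 π L)) (x : X) : Prop :=
  IsClosed {x} ∧ v ≠ 0 ∧ LinearMap.ker v = H0Ideal π L {x}

/-- `f = v₁ + ⋯ + v_k` with `[v_i] = z_i ∈ X`. -/
def IsDecomposition (L : X.Modules) (f : Module.Dual ℂ (H0 π L)) {k : ℕ}
    (v : Fin k → Module.Dual ℂ (H0 π L)) (z : Fin k → X) : Prop :=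
  f = ∑ i, v i ∧ ∀ i, Represents π L (v i) (z i)

/-- A decomposition of `f` with the least possible number of summands. -/
def IsMinimalDecomposition (L : X.Modules) (f : Module.Dual ℂ (H0 π L)) {k : ℕ}
    (v : Fin k → Module.Dual ℂ (H0 π L)) (z : Fin k → X) : Prop :=
  IsDecomposition π L f v z ∧
    ∀ (m : ℕ) (v' : Fin m → Module.Dual ℂ (H0 π L)) (z' : Fin m → X),
      IsDecomposition π L f v' z' → k ≤ m

end

end WaringBundle

/-! Both equalities are inclusions between subspaces of the same finite codimension.

Each `v i` kills the sections of `L` vanishing at `z i`, so `f` kills those vanishing on `Z`.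
Contraction sends a pair to a section vanishing on `Z` as soon as one member vanishes there
(`VanishesOn.contractHom_left`, `VanishesOn.contractHom_right`). Hence each left-hand side lies in
the corresponding right-hand side.

Conversely, the residue field at a closed point is `ℂ`, so vanishing there imposes at most `e`
linear conditions on sections of a sheaf locally generated by `e` sections. Both left-hand sides
thus have codimension at most `k * e` (`rank_quotient_H0Ideal_le`), while `ker A_f` and `(im A_f)^⊥`
have codimension `rank A_f = k * e`. Only this upper bound is needed, so for `E^* ⊗ L` local
generators suffice. The spaces of sections may be infinite-dimensional, so dimensions are compared
in quotients. -/

namespace WaringBundle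

/-! ### Values of functions at closed points -/

/-- At a closed point of a scheme locally of finite type over `ℂ`, the value of a regular
function is a complex number. -/
theorem exists_evaluation_eq {X : Scheme.{0}} (π : X ⟶ Spec (.of ℂ)) [LocallyOfFiniteType π]
    {x : X} (hx : IsClosed {x}) {U : X.Opens} (hxU : x ∈ U) (g : Γ(X, U)) :
    ∃ c : ℂ, X.evaluation U x hxU (resO X le_top (structureHom π c)) =
      X.evaluation U x hxU g := by
  -- The composite `ℂ → Γ(X, ⊤) → κ(x)` is the inverse of the isomorphism `κ(x) ≅ ℂ`; this is read
  -- off on global sections from the corresponding identity of maps of spectra.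
  have hinv : (X.evaluation ⊤ x trivial).hom.comp (structureHom π) =
      (residueFieldIsoBase π x hx).inv.hom := by
    have h0 : Spec.map (residueFieldIsoBase π x hx).inv = X.fromSpecResidueField x ≫ π :=
      SpecMap_residueFieldIsoBase_inv π x hx
    have h1 := congrArg (fun k => (Scheme.ΓSpecIso (.of ℂ)).inv ≫ k.appTop ≫
      (Scheme.ΓSpecIso (X.residueField x)).hom) h0
    simp only [Scheme.ΓSpecIso_naturality, Iso.inv_hom_id_assoc, Scheme.Hom.comp_appTop,
      Category.assoc] at h1
    rw [h1, Scheme.fromSpecResidueField, Scheme.Hom.comp_appTop, Category.assoc,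
      Scheme.ΓSpecIso_naturality, Scheme.fromSpecStalk_appTop]
    have h2 : (Spec (X.presheaf.stalk x)).presheaf.map
        (homOfLE (le_top : (⊤ : (Spec (X.presheaf.stalk x)).Opens) ≤ ⊤)).op = 𝟙 _ :=
      (Spec (X.presheaf.stalk x)).presheaf.map_id _
    simp only [Category.assoc]
    erw [h2]
    simp
    rfl
  refine ⟨(residueFieldIsoBase π x hx).hom (X.evaluation U x hxU g), ?_⟩
  have h1 := congrArg (fun k => (k ≫ X.residue x).hom
    (structureHom π ((residueFieldIsoBase π x hx).hom (X.evaluation U x hxU g))))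
    (X.presheaf.germ_res (homOfLE (le_top : U ≤ ⊤)) x hxU)
  refine h1.trans ?_
  refine (RingHom.congr_fun hinv _).trans ?_
  exact ConcreteCategory.congr_hom (residueFieldIsoBase π x hx).hom_inv_id _

variable {X : Scheme.{0}}

/-! ### Sections of `E^* ⊗ L` and pure tensors -/

section TensorProduct

variable {E L : X.Modules}

/-- The canonical map from the presheaf tensor product to its sheafification. -/
noncomputable def toDualTensor (E L : X.Modules) (U : X.Opens) :
    TensorProduct Γ(X, U) (DualSection E U) Γ(L, U) →ₗ[Γ(X, U)] Γ(dualTensor E L, U) :=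
  ((PresheafOfModules.sheafificationHomEquiv (𝟙 X.ringCatSheaf.obj)
    (P := PresheafOfModules.Monoidal.tensorObj (R := X.presheaf) (dual E) L.val)
    (F := dualTensor E L) (𝟙 _)).app (.op U)).hom

/-- The section `φ ⊗ l` is linear in `φ` and in `l`. -/
noncomputable def tmulHom (E L : X.Modules) (U : X.Opens) :
    DualSection E U →ₗ[Γ(X, U)] Γ(L, U) →ₗ[Γ(X, U)] Γ(dualTensor E L, U) :=
  (TensorProduct.mk Γ(X, U) (DualSection E U) Γ(L, U)).compr₂ (toDualTensor E L U)

theorem tmulHom_apply {U : X.Opens} (φ : DualSection E U) (l : Γ(L, U)) :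
    tmulHom E L U φ l = tmul φ l := rfl

theorem res_tmul {U V : X.Opens} (h : V ≤ U) (φ : DualSection E U) (l : Γ(L, U)) :
    res (dualTensor E L) h (tmul φ l) = tmul (φ.restrict h) (res L h l) := by
  unfold tmul
  exact (PresheafOfModules.naturality_apply
    (PresheafOfModules.sheafificationHomEquiv (𝟙 X.ringCatSheaf.obj)
      (P := PresheafOfModules.Monoidal.tensorObj (R := X.presheaf) (dual E) L.val)
      (F := dualTensor E L) (𝟙 _)) (homOfLE h).op
    (show _ from TensorProduct.tmul Γ(X, U) φ l)).symm

/-- Contraction with a global section commutes with restriction. -/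
theorem res_contractHom (s : Γ(E, ⊤)) {U V : X.Opens} (h : V ≤ U) (t : Γ(dualTensor E L, U)) :
    res L h ((contractHom E L s).app U t) =
      (contractHom E L s).app V (res (dualTensor E L) h t) :=
  (PresheafOfModules.naturality_apply (contractHom E L s).val (homOfLE h).op t).symm

/-- Locally, every section of `E^* ⊗ L` is a sum of sections `φ ⊗ l`. -/
theorem exists_res_mem_closure_tmul {U : X.Opens} (t : Γ(dualTensor E L, U)) {x : X} (hx : x ∈ U) :
    ∃ (V : X.Opens) (h : V ≤ U), x ∈ V ∧ res (dualTensor E L) h t ∈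
      AddSubmonoid.closure {a | ∃ (φ : DualSection E V) (l : Γ(L, V)), a = tmul φ l} := by
  -- The map from a presheaf to its sheafification is locally surjective.
  have hs : Presheaf.IsLocallySurjective (Opens.grothendieckTopology X)
    (CategoryTheory.toSheafify (Opens.grothendieckTopology X)
      (PresheafOfModules.Monoidal.tensorObj (R := X.presheaf) (dual E) L.val).presheaf) :=
    inferInstance
  obtain ⟨V, f, ⟨τ, hτ⟩, hxV⟩ := hs.imageSieve_mem t x hx
  refine ⟨V, leOfHom f, hxV, ?_⟩
  have hadd : ∀ τ, toDualTensor E L V τ ∈ AddSubmonoid.closure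
      {a | ∃ (φ : DualSection E V) (l : Γ(L, V)), a = tmul φ l} := by
    intro τ
    induction τ using TensorProduct.induction_on with
    | zero =>
      rw [map_zero]
      exact zero_mem _
    | tmul φ l => exact AddSubmonoid.subset_closure ⟨φ, l, rfl⟩
    | add a b ha hb =>
      rw [map_add]
      exact add_mem ha hb
  have : res (dualTensor E L) (leOfHom f) t = _ := hτ.symm
  rw [this]
  exact hadd τ

end TensorProduct

end WaringBundle

namespace WaringBundle

variable {X : Scheme.{0}}

/-! ### Local generators -/

/-- Near every point there are `e` sections that generate the germs of the global sections. -/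
def IsLocallyGeneratedBy (M : X.Modules) (e : ℕ) : Prop :=
  ∀ x : X, ∃ (U : X.Opens) (_ : x ∈ U) (b : Fin e → Γ(M, U)), ∀ s : Γ(M, ⊤),
    ∃ (V : X.Opens) (h : V ≤ U) (c : Fin e → Γ(X, V)), x ∈ V ∧
      res M le_top s = ∑ j, c j • res M h (b j)

theorem IsLocallyFreeOfRank.isLocallyGeneratedBy {M : X.Modules} {e : ℕ}
    (hM : IsLocallyFreeOfRank M e) : IsLocallyGeneratedBy M e := by
  intro x
  obtain ⟨U, hxU, b, hb⟩ := hM x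
  refine ⟨U, hxU, b, fun s => ?_⟩
  obtain ⟨c, hc⟩ := (hb U le_rfl).2 (res M le_top s)
  exact ⟨U, le_rfl, c, hxU, hc.symm⟩

/-- Coordinates in a frame are unique, hence linear and compatible with restriction; so they are
sections of the dual sheaf. -/
theorem exists_dual_frame {E : X.Modules} {e : ℕ} {U : X.Opens} {b : Fin e → Γ(E, U)}
    (hb : ∀ (V : X.Opens) (h : V ≤ U),
      Function.Bijective fun c : Fin e → Γ(X, V) => ∑ j, c j • res E h (b j)) :
    ∃ β : Fin e → DualSection E U, ∀ (V : X.Opens) (h : V ≤ U) (s : Γ(E, V)),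
      ∑ j, (β j).app V h s • res E h (b j) = s := by
  choose c hc using fun (V : X.Opens) (h : V ≤ U) (s : Γ(E, V)) => (hb V h).2 s
  have hadd : ∀ V h s t, c V h (s + t) = c V h s + c V h t := fun V h s t => (hb V h).1 <| by
    simp only [hc, Pi.add_apply, add_smul, Finset.sum_add_distrib]
  have hsmul : ∀ (V : X.Opens) (h : V ≤ U) (r : Γ(X, V)) (s : Γ(E, V)),
      c V h (r • s) = r • c V h s := fun V h r s => (hb V h).1 <| by
    simp only [hc, Pi.smul_apply, smul_assoc, ← Finset.smul_sum]
  have hres : ∀ (V W : X.Opens) (hV : V ≤ U) (hW : W ≤ V) (s : Γ(E, V)),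
      (fun j => resO X hW (c V hV s j)) = c W (hW.trans hV) (res E hW s) :=
    fun V W hV hW s => (hb W (hW.trans hV)).1 <| by
      simp only [hc]
      conv_rhs => rw [← hc V hV s]
      simp only [map_sum, res_smul, res_res]
  refine ⟨fun j => ⟨fun V h => ⟨⟨fun s => c V h s j, fun s t => congrFun (hadd V h s t) j⟩,
    fun r s => congrFun (hsmul V h r s) j⟩, fun V W hV hW s => congrFun (hres V W hV hW s) j⟩,
    fun V h s => hc V h s⟩

/-- A local frame of `E` and a local generator of `L` give local generators of `E^* ⊗ L`. -/
theorem isLocallyGeneratedBy_dualTensor {E L : X.Modules} {e : ℕ}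
    (hE : IsLocallyFreeOfRank E e) (hL : IsLocallyFreeOfRank L 1) :
    IsLocallyGeneratedBy (dualTensor E L) e := by
  intro x
  obtain ⟨U₁, hx₁, b, hb⟩ := hE x
  obtain ⟨U₂, hx₂, l, hl⟩ := hL x
  obtain ⟨β, hβ⟩ := exists_dual_frame hb
  refine ⟨U₁ ⊓ U₂, ⟨hx₁, hx₂⟩, fun j =>
    tmul ((β j).restrict inf_le_left) (res L inf_le_right (l 0)), fun t => ?_⟩
  -- This neighbourhood depends on `t`, which is why `IsLocallyGeneratedBy` lets the open set shrink
  -- with the section.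
  obtain ⟨V, _, hxV, ht⟩ := exists_res_mem_closure_tmul t (x := x) trivial
  have h₁ : U₁ ⊓ U₂ ⊓ V ≤ U₁ := inf_le_left.trans inf_le_left
  have h₂ : U₁ ⊓ U₂ ⊓ V ≤ U₂ := inf_le_left.trans inf_le_right
  have hV : U₁ ⊓ U₂ ⊓ V ≤ V := inf_le_right
  -- Dual basis expansion: a functional is determined by its values on the frame.
  have hβ' : ∀ φ : DualSection E (U₁ ⊓ U₂ ⊓ V),
      φ = ∑ j, φ.app _ le_rfl (res E h₁ (b j)) • (β j).restrict h₁ := by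
    intro φ
    ext W hW s
    have happ : ∀ (T : Finset (Fin e)) (ψ : Fin e → DualSection E (U₁ ⊓ U₂ ⊓ V)),
        (∑ j ∈ T, ψ j).app W hW s = ∑ j ∈ T, (ψ j).app W hW s := fun T ψ =>
      map_sum (AddMonoidHom.mk' (fun χ : DualSection E (U₁ ⊓ U₂ ⊓ V) => χ.app W hW s)
        fun _ _ => rfl) ψ T
    rw [happ]
    conv_lhs => rw [← hβ W (hW.trans h₁) s]
    simp only [map_sum, map_smul, DualSection.smul_app, LinearMap.smul_apply, φ.res_app, res_res,
      smul_eq_mul]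
    exact Finset.sum_congr rfl fun j _ => mul_comm _ _
  have key : ∀ a ∈ AddSubmonoid.closure {a | ∃ (φ : DualSection E V) (m : Γ(L, V)),
      a = tmul φ m}, ∃ c : Fin e → Γ(X, U₁ ⊓ U₂ ⊓ V), res (dualTensor E L) hV a =
        ∑ j, c j • tmul ((β j).restrict h₁) (res L h₂ (l 0)) := by
    intro a ha
    induction ha using AddSubmonoid.closure_induction with
    | mem a ha =>
      obtain ⟨φ, m, rfl⟩ := ha
      obtain ⟨c, hc⟩ := (hl _ h₂).2 (res L hV m)
      simp only [Fin.sum_univ_one] at hc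
      -- With `m = c 0 • l 0` and `φ = ∑ φ(b j) • β j`, bilinearity gives these coefficients of `φ ⊗
      -- m`.
      refine ⟨fun j => c 0 * (φ.restrict hV).app _ le_rfl (res E h₁ (b j)), ?_⟩
      rw [res_tmul, ← hc, ← tmulHom_apply]
      conv_lhs => rw [hβ' (φ.restrict hV)]
      simp only [map_sum, map_smul, LinearMap.sum_apply, LinearMap.smul_apply, Finset.smul_sum,
        smul_smul, tmulHom_apply]
    | zero => exact ⟨0, by simp⟩
    | add a a' _ _ ha ha' =>
      obtain ⟨c, hc⟩ := ha
      obtain ⟨c', hc'⟩ := ha'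
      exact ⟨c + c', by simp [hc, hc', add_smul, Finset.sum_add_distrib]⟩
  obtain ⟨c, hc⟩ := key _ ht
  refine ⟨U₁ ⊓ U₂ ⊓ V, inf_le_left, c, ⟨⟨hx₁, hx₂⟩, hxV⟩, ?_⟩
  rw [res_res] at hc
  rw [hc]
  refine Finset.sum_congr rfl fun j _ => ?_
  rw [res_tmul, res_res]
  rfl

/-! ### Sections vanishing at points -/

theorem idealOf_anti {Z Z' : Set X} (h : Z ⊆ Z') (U : X.Opens) : idealOf Z' U ≤ idealOf Z U := by
  intro g hg
  rw [mem_idealOf] at hg ⊢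
  exact fun x hx hxZ => hg x hx (h hxZ)

theorem VanishesOn.mono {M : X.Modules} {Z Z' : Set X} (h : Z ⊆ Z') {s : Γ(M, ⊤)}
    (hs : VanishesOn M Z' s) : VanishesOn M Z s := by
  intro x
  obtain ⟨U, hxU, hU⟩ := hs x
  exact ⟨U, hxU, Submodule.smul_mono_left (idealOf_anti h U) hU⟩

/-- The sections over `U` whose germ at `x` lies in `𝔪_x M_x`. -/
def vanishingAt (M : X.Modules) (x : X) (U : X.Opens) (hxU : x ∈ U) :
    Submodule Γ(X, U) Γ(M, U) where
  carrier := {s | ∃ (V : X.Opens) (h : V ≤ U), x ∈ V ∧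
    res M h s ∈ idealOf {x} V • (⊤ : Submodule Γ(X, V) Γ(M, V))}
  zero_mem' := ⟨U, le_rfl, hxU, by rw [map_zero]; exact zero_mem _⟩
  add_mem' := by
    rintro a b ⟨V, hV, hxV, ha⟩ ⟨W, hW, hxW, hb⟩
    refine ⟨V ⊓ W, inf_le_left.trans hV, ⟨hxV, hxW⟩, ?_⟩
    have ha' := res_mem_smul_top M (inf_le_left : V ⊓ W ≤ V) ha
    have hb' := res_mem_smul_top M (inf_le_right : V ⊓ W ≤ W) hb
    rw [res_res] at ha' hb'
    rw [map_add]
    exact add_mem ha' hb'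
  smul_mem' := by
    rintro r a ⟨V, hV, hxV, ha⟩
    refine ⟨V, hV, hxV, ?_⟩
    rw [res_smul]
    exact Submodule.smul_mem _ _ ha

theorem mem_vanishingAt_of_res_mem {M : X.Modules} {x : X} {U V : X.Opens} (h : V ≤ U)
    (hxV : x ∈ V) {s : Γ(M, U)} (hs : res M h s ∈ vanishingAt M x V hxV) :
    s ∈ vanishingAt M x U (h hxV) := by
  obtain ⟨W, hW, hxW, hs⟩ := hs
  rw [res_res] at hs
  exact ⟨W, hW.trans h, hxW, hs⟩

/-- A finite set of closed points is discrete: every `x` has a neighbourhood meeting `Z` at most in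
`x`, on which `I_Z` is the ideal of `x` or the unit ideal. -/
theorem vanishesOn_of_forall_mem_vanishingAt {M : X.Modules} {Z : Set X} (hZ : Z.Finite)
    (hcl : ∀ z ∈ Z, IsClosed {z}) {s : Γ(M, ⊤)}
    (hs : ∀ z ∈ Z, s ∈ vanishingAt M z ⊤ trivial) : VanishesOn M Z s := by
  intro x
  have hF : IsClosed (Z \ {x}) := by
    rw [← Set.biUnion_of_singleton (Z \ {x})]
    exact hZ.sdiff.isClosed_biUnion fun z hz => hcl z hz.1
  let U₀ : X.Opens := ⟨(Z \ {x})ᶜ, hF.isOpen_compl⟩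
  have hxU₀ : x ∈ U₀ := fun h => h.2 rfl
  by_cases hx : x ∈ Z
  · obtain ⟨V, hV, hxV, h⟩ := hs x hx
    refine ⟨V ⊓ U₀, ⟨hxV, hxU₀⟩, ?_⟩
    have h' := res_mem_smul_top M (inf_le_left : V ⊓ U₀ ≤ V) h
    rw [res_res] at h'
    refine Submodule.smul_mono_left (fun g hg => ?_) h'
    rw [mem_idealOf] at hg ⊢
    intro y hy hyZ
    exact hg y hy (by_contra fun hne => hy.2 ⟨hyZ, hne⟩)
  · refine ⟨U₀, hxU₀, ?_⟩
    have : idealOf Z U₀ = ⊤ := by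
      rw [eq_top_iff]
      intro g _
      rw [mem_idealOf]
      intro y hy hyZ
      exact (hy ⟨hyZ, fun h => hx (h ▸ hyZ)⟩).elim
    rw [this, Submodule.top_smul]
    trivial

/-! ### Linear conditions imposed by closed points -/

variable (π : X ⟶ Spec (.of ℂ))

/-- At a closed point, every global section is a complex combination of given local generators,
modulo sections vanishing at the point. -/
theorem exists_sub_mem_vanishingAt [LocallyOfFiniteType π] {M : X.Modules} {e : ℕ}
    (hM : IsLocallyGeneratedBy M e) {x : X} (hx : IsClosed {x}) :
    ∃ (U : X.Opens) (hxU : x ∈ U) (b : Fin e → Γ(M, U)), ∀ s : Γ(M, ⊤), ∃ γ : Fin e → ℂ,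
      res M le_top s - ∑ j, resO X (le_top : U ≤ ⊤) (structureHom π (γ j)) • b j ∈
        vanishingAt M x U hxU := by
  obtain ⟨U, hxU, b, hb⟩ := hM x
  refine ⟨U, hxU, b, fun s => ?_⟩
  obtain ⟨V, hV, c, hxV, hc⟩ := hb s
  -- Replacing each coefficient by its value at `x` changes the section only by an element of `I_x
  -- M`.
  choose γ hγ using fun j => exists_evaluation_eq π hx hxV (c j)
  refine ⟨γ, V, hV, hxV, ?_⟩
  simp only [map_sub, map_sum, res_smul, res_res, resO_resO, hc, ← Finset.sum_sub_distrib,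
    ← sub_smul]
  refine sum_mem fun j _ => Submodule.smul_mem_smul ?_ trivial
  rw [mem_idealOf]
  rintro y hy rfl
  rw [map_sub, hγ, sub_self]

/-- Vanishing at `k` closed points imposes at most `k e` linear conditions on the sections of a
sheaf that is locally generated by `e` sections. -/
theorem rank_quotient_H0Ideal_le [LocallyOfFiniteType π] {M : X.Modules} {e k : ℕ}
    (hM : IsLocallyGeneratedBy M e) {z : Fin k → X} (hz : ∀ i, IsClosed {z i}) :
    Module.rank ℂ (H0 π M ⧸ H0Ideal π M (Set.range z)) ≤ (k * e : ℕ) := by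
  choose U hU b hb using fun i => exists_sub_mem_vanishingAt π hM (hz i)
  refine rank_le fun S hS => ?_
  by_contra! hcard
  choose s hs using fun a : S => Submodule.mkQ_surjective _ a.1
  choose γ hγ using fun (a : S) (i : Fin k) => hb i (s a)
  -- More than `k * e` sections have a nontrivial relation `c` among their coordinates at all the
  -- points; the combination with coefficients `c` then vanishes on `Z`, contradicting independence
  -- in the quotient.
  let T : (S → ℂ) →ₗ[ℂ] (Fin k × Fin e → ℂ) :=
    (Matrix.of fun (p : Fin k × Fin e) a => γ a p.1 p.2).mulVecLin
  have hT : LinearMap.ker T ≠ ⊥ := LinearMap.ker_ne_bot_of_finrank_lt (by simpa using hcard)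
  obtain ⟨c, hc, hc0⟩ := (Submodule.ne_bot_iff _).1 hT
  have hc' : ∀ i j, ∑ a, c a * γ a i j = 0 := fun i j => by
    have := congrFun (LinearMap.mem_ker.1 hc) (i, j)
    simpa [T, Matrix.mulVec, dotProduct, mul_comm] using this
  have hmem : ∑ a, c a • s a ∈ H0Ideal π M (Set.range z) := by
    refine vanishesOn_of_forall_mem_vanishingAt (Set.finite_range z)
      (Set.forall_mem_range.2 hz) (Set.forall_mem_range.2 fun i => mem_vanishingAt_of_res_mem le_top (hU i) ?_)
    have hsum : ∀ t : S → Γ(M, ⊤), res M (le_top : U i ≤ ⊤) (∑ a, structureHom π (c a) • t a) =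
        ∑ a, resO X (le_top : U i ≤ ⊤) (structureHom π (c a)) • res M (le_top : U i ≤ ⊤) (t a) :=
      fun t => by simp only [map_sum, res_smul]
    -- By the choice of `c` the generator parts cancel, so subtracting them leaves a combination of
    -- terms that vanish at `z i`.
    have hzero : ∑ a, resO X (le_top : U i ≤ ⊤) (structureHom π (c a)) •
        ∑ j, resO X (le_top : U i ≤ ⊤) (structureHom π (γ a i j)) • b i j = 0 := by
      simp only [Finset.smul_sum, smul_smul, ← map_mul]
      rw [Finset.sum_comm]
      simp only [← Finset.sum_smul, ← map_sum, hc', map_zero, zero_smul, Finset.sum_const_zero]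
    refine (hsum s).symm ▸ ?_
    rw [← sub_zero (∑ a, _), ← hzero, ← Finset.sum_sub_distrib]
    simp only [← smul_sub]
    exact sum_mem fun a _ => Submodule.smul_mem _ _ (hγ a i)
  refine hc0 (funext fun a => Fintype.linearIndependent_iff.1 hS c ?_ a)
  simp only [← hs, ← map_smul, ← map_sum]
  exact (Submodule.Quotient.mk_eq_zero _).2 hmem

/-! ### Contraction and vanishing -/

/-- Locally `t` is a sum of pure tensors `φ ⊗ m`, and linearity of `φ` puts `φ(s)` in `I_Z`, so
`φ(s) m` lies in `I_Z L`. -/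
theorem VanishesOn.contractHom_left {E L : X.Modules} {Z : Set X} {s : Γ(E, ⊤)}
    (hs : VanishesOn E Z s) (t : Γ(dualTensor E L, ⊤)) :
    VanishesOn L Z ((contractHom E L s).app ⊤ t) := by
  intro x
  obtain ⟨U, hxU, hU⟩ := hs x
  obtain ⟨V, _, hxV, ht⟩ := exists_res_mem_closure_tmul t (x := x) trivial
  refine ⟨U ⊓ V, ⟨hxU, hxV⟩, ?_⟩
  have hU' := res_mem_smul_top E (inf_le_left : U ⊓ V ≤ U) hU
  rw [res_res] at hU'
  have key : ∀ a ∈ AddSubmonoid.closure {a | ∃ (φ : DualSection E V) (m : Γ(L, V)),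
      a = tmul φ m}, res L (inf_le_right : U ⊓ V ≤ V) ((contractHom E L s).app V a) ∈
        idealOf Z (U ⊓ V) • (⊤ : Submodule Γ(X, U ⊓ V) Γ(L, U ⊓ V)) := by
    intro a ha
    induction ha using AddSubmonoid.closure_induction with
    | mem a ha =>
      obtain ⟨φ, m, rfl⟩ := ha
      rw [contractHom_tmul, contract_aux]
      refine Submodule.smul_mem_smul ?_ trivial
      have := Submodule.mem_map_of_mem
        (f := (φ.restrict (inf_le_right : U ⊓ V ≤ V)).app _ le_rfl) hU'
      rw [Submodule.map_smul''] at this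
      simpa using Submodule.smul_mono (le_refl (idealOf Z (U ⊓ V))) le_top this
    | zero =>
      rw [map_zero, map_zero]
      exact zero_mem _
    | add a a' _ _ ha ha' =>
      rw [map_add, map_add]
      exact add_mem ha ha'
  have := key _ ht
  rwa [← res_contractHom, res_res] at this

/-- Contraction with a fixed `s` is `𝒪_X`-linear, so it carries `I_Z`-multiples to `I_Z`-multiples.
-/
theorem VanishesOn.contractHom_right {E L : X.Modules} {Z : Set X} (s : Γ(E, ⊤))
    {t : Γ(dualTensor E L, ⊤)} (ht : VanishesOn (dualTensor E L) Z t) :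
    VanishesOn L Z ((contractHom E L s).app ⊤ t) := by
  intro x
  obtain ⟨U, hxU, hU⟩ := ht x
  refine ⟨U, hxU, ?_⟩
  rw [res_contractHom]
  refine Submodule.smul_induction_on hU (fun r hr n _ => ?_) (fun a b ha hb => ?_)
  · rw [Scheme.Modules.Hom.app_smul]
    exact Submodule.smul_mem_smul hr trivial
  · rw [map_add]
    exact add_mem ha hb

/-! ### Linear algebra -/

/-- The surjection `V ⧸ P → V ⧸ Q` is between finite-dimensional spaces of equal dimension, hence
injective. -/
theorem eq_of_le_of_finrank_quotient_le {K V : Type*} [Field K] [AddCommGroup V]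
    [Module K V] {P Q : Submodule K V} (h : P ≤ Q) [Module.Finite K (V ⧸ P)]
    (hr : Module.finrank K (V ⧸ P) ≤ Module.finrank K (V ⧸ Q)) : P = Q := by
  have hsurj : Function.Surjective (Submodule.factor h) := Submodule.factor_surjective h
  have : Module.Finite K (V ⧸ Q) := Module.Finite.of_surjective _ hsurj
  have heq : Module.finrank K (V ⧸ P) = Module.finrank K (V ⧸ Q) :=
    hr.antisymm (LinearMap.finrank_le_finrank_of_surjective hsurj)
  have hinj := (LinearMap.injective_iff_surjective_of_finrank_eq_finrank heq).2 hsurj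
  refine h.antisymm fun x hx => ?_
  rw [← Submodule.Quotient.mk_eq_zero]
  exact hinj (by simpa using hx)

end WaringBundle

/-! ### Comparison of codimensions -/

theorem mainTheorem10 (X : AlgebraicGeometry.Scheme.{0})
    (π : X ⟶ AlgebraicGeometry.Spec (CommRingCat.of ℂ))
    [AlgebraicGeometry.IsReduced X] [AlgebraicGeometry.IsSeparated π]
    [AlgebraicGeometry.LocallyOfFiniteType π] [AlgebraicGeometry.QuasiCompact π]
    (L : X.Modules) (hL : WaringBundle.IsLocallyFreeOfRank L 1)
    (hemb : WaringBundle.SeparatesPointsAndTangents π L)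
    (E : X.Modules) (e : ℕ) (hE : WaringBundle.IsLocallyFreeOfRank E e)
    (f : Module.Dual ℂ (WaringBundle.H0 π L)) (k : ℕ)
    (v : Fin k → Module.Dual ℂ (WaringBundle.H0 π L)) (z : Fin k → X)
    (hmin : WaringBundle.IsMinimalDecomposition π L f v z)
    (hrank : Module.finrank ℂ (LinearMap.range (WaringBundle.mapA π E L f)) = k * e) :
    WaringBundle.H0Ideal π E (Set.range z) = LinearMap.ker (WaringBundle.mapA π E L f) ∧
    WaringBundle.H0Ideal π (WaringBundle.dualTensor E L) (Set.range z) =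
      (LinearMap.range (WaringBundle.mapA π E L f)).dualCoannihilator := by
  obtain ⟨⟨hf, hv⟩, -⟩ := hmin
  have hzero : ∀ u ∈ WaringBundle.H0Ideal π L (Set.range z), f u = 0 := by
    intro u hu
    rw [hf, LinearMap.sum_apply]
    refine Finset.sum_eq_zero fun i _ => ?_
    rw [← LinearMap.mem_ker, (hv i).2.2]
    exact WaringBundle.VanishesOn.mono (Set.singleton_subset_iff.2 (Set.mem_range_self i)) hu
  have hE' := WaringBundle.rank_quotient_H0Ideal_le π hE.isLocallyGeneratedBy fun i => (hv i).1
  have hT' := WaringBundle.rank_quotient_H0Ideal_le π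
    (WaringBundle.isLocallyGeneratedBy_dualTensor hE hL) fun i => (hv i).1
  -- The bound on the cardinal rank supplies finiteness, which a bound on `finrank` alone would not.
  have hfin : Module.Finite ℂ (WaringBundle.H0 π E ⧸ WaringBundle.H0Ideal π E (Set.range z)) :=
    Module.rank_lt_aleph0_iff.1 (hE'.trans_lt (Cardinal.natCast_lt_aleph0))
  have : Module.Finite ℂ (WaringBundle.H0 π (WaringBundle.dualTensor E L) ⧸
      WaringBundle.H0Ideal π (WaringBundle.dualTensor E L) (Set.range z)) :=
    Module.rank_lt_aleph0_iff.1 (hT'.trans_lt (Cardinal.natCast_lt_aleph0))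
  have hle : WaringBundle.H0Ideal π E (Set.range z) ≤
      LinearMap.ker (WaringBundle.mapA π E L f) := fun s hs =>
    LinearMap.ext fun t => hzero _ (WaringBundle.VanishesOn.contractHom_left hs t)
  have hker : WaringBundle.H0Ideal π E (Set.range z) =
      LinearMap.ker (WaringBundle.mapA π E L f) := by
    refine WaringBundle.eq_of_le_of_finrank_quotient_le hle ?_
    rw [(WaringBundle.mapA π E L f).quotKerEquivRange.finrank_eq, hrank]
    exact Module.finrank_le_of_rank_le hE'
  refine ⟨hker, WaringBundle.eq_of_le_of_finrank_quotient_le (fun t ht => ?_) ?_⟩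
  · rw [Submodule.mem_dualCoannihilator]
    rintro _ ⟨s, rfl⟩
    exact hzero _ (WaringBundle.VanishesOn.contractHom_right s ht)
  -- The first equality makes `im A_f` finite-dimensional; the pairing then identifies the quotient
  -- by `(im A_f)^⊥` with the dual of `im A_f`, of dimension `k * e`.
  · have : Module.Finite ℂ (WaringBundle.H0 π E ⧸ LinearMap.ker (WaringBundle.mapA π E L f)) :=
      hker ▸ hfin
    have : FiniteDimensional ℂ (LinearMap.range (WaringBundle.mapA π E L f)) :=
      Module.Finite.equiv (WaringBundle.mapA π E L f).quotKerEquivRange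
    rw [(LinearEquiv.ofBijective _
      (Subspace.quotDualCoannihilatorToDual_bijective
        (LinearMap.range (WaringBundle.mapA π E L f)))).finrank_eq, Subspace.dual_finrank_eq, hrank]
    exact Module.finrank_le_of_rank_le hT'
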